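/- Let $\mathbb Z_2[z^{\pm}]$ be the ring of Laurent polynomials over the two-element field. A $\delta$-parametric polynomial is a formal expression $\mathbf f=\sum_{i} f_i(z)\,z^{i\delta}$, where $f_i\in\mathbb Z_2[z^{\pm}]$ for $i\in\mathbb Z$ and only finitely many $f_i$ are nonzero; substituting $\delta\in\mathbb Z$ gives $\mathbf f_\delta\in\mathbb Z_2[z^{\pm}]$. It is nontrivial if some $f_i\neq 0$, and then $\deg_\delta\mathbf f$ and $\operatorname{ord}_\delta\mathbf f$ are the largest and the smallest $i$ with $f_i\ne 0$. For nontrivial $\mathbf f,\mathbf g$ put $$\Delta=(\deg_\delta\mathbf g-\operatorname{ord}_\delta\mathbf g)-(\deg_\delta\mathbf f-\operatorname{ord}_\delta\mathbf f).$$ A witness for $(\mathbf f,\mathbf g)$ is an integer $\delta$ (of any sign) with $\mathbf f_\delta\mid\mathbf g_\delta$ in $\mathbb Z_2[z^{\pm}]$; the pair is a positive instance of the divisibility problem if it has a witness. A sequence $(F_\delta)_{\delta\ge 0}$ in $\mathbb Z_2[z^{\pm}]$ is $(A,p)$-periodic, where $A\ge 0$ and $p\geq 1$ are integers, if there are integers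 $s\le t$ and bit strings $n_s,\dots,n_t\in\{0,1\}^{2A+1}$, $p_s,\dots,p_{t-1}\in\{0,1\}^{p}$ such that for all sufficiently large $\delta$ the string $$n_s\, p_s^{(\delta-2A-1)}\, n_{s+1}\cdots n_{t-1}\, p_{t-1}^{(\delta-2A-1)}\, n_t$$ lists, by increasing exponent and ending with the exponent $\delta t+A$, the coefficients of $F_\delta$, all other coefficients of $F_\delta$ being zero. Here $w^{(k)}$ is the prefix of length $k$ of $w^k$. For $0\ne f\in\mathbb Z_2[z^{\pm}]$ let $F=z^{-\operatorname{ord} f}f\in\mathbb Z_2[z]$, where $\operatorname{ord} f$ is the least exponent occurring in $f$. The maps $h\mapsto hz \bmod F$ and $h\mapsto hz+1 \bmod F$ permute the polynomials in $\mathbb{Z}_2[z]$ of degree less than $\deg F$; let $P_f$ be the order of the finite permutation group that they generate. **Statement.** Let $\mathbf f=\sum_{i=s}^t f_i(z)z^{i\delta}$ (with $f_s,f_t\ne 0$) and $\mathbf g$ be nontrivial $\delta$-parametric polynomials, and let $A\le B$ be nonnegative integers such that $(\mathbf f_\delta)_{\delta\ge0}$ is $(A,1)$-periodic and $(\mathbf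 g_\delta)_{\delta\ge0}$ is $(B,1)$-periodic. Suppose that $(\mathbf f,\mathbf g)$ is a positive instance of the divisibility problem. 1. If $\Delta\ge 0$, then $(\mathbf f,\mathbf g)$ has a witness $\delta$ with $$-\bigl(P_{f_s}^{\Delta}+2(B+4A\Delta)+4A+1\bigr)\ \le\ \delta\ \le\ P_{f_t}^{\Delta}+2(B+4A\Delta)+4A+1 .$$ 2. If $\Delta<0$, then $(\mathbf f,\mathbf g)$ has a witness $\delta$ with $-(2B+2A)\le\delta\le 2B+2A$. Both parts hold under either convention for a zero divisor: when $0\mid 0$ is counted as true, and when a witness is required to satisfy $\mathbf f_\delta\neq0$ (in the hypothesis and in the conclusion). -/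

import Mathlib

noncomputable section

namespace LamplighterDiv

/-- Laurent polynomials over the field with two elements. -/
abbrev Laurent := LaurentPolynomial (ZMod 2)

/-- The order of a Laurent polynomial: the least exponent that occurs (`0` for the zero
polynomial). -/
def lord (f : Laurent) : ℤ :=
  if h : f.coeff.support.Nonempty then f.coeff.support.min' h else 0

/-! ### Parametric polynomials -/

/-- A `δ`-parametric polynomial `∑ᵢ fᵢ(z) z^(iδ)`, given by its finitely supported family of
blocks `fᵢ`, indexed by `i : ℤ`. It is nontrivial when it is not `0`. -/
abbrev ParamPoly := ℤ →₀ Laurent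

/-- The instantiation `f_δ = ∑ᵢ fᵢ(z) z^(iδ)`, a Laurent polynomial. -/
def inst (f : ParamPoly) (δ : ℤ) : Laurent :=
  f.sum fun i fi => fi * LaurentPolynomial.T (i * δ)

/-- The `δ`-degree: the largest index of a nonzero block (`0` for the trivial one). -/
def degDelta (f : ParamPoly) : ℤ :=
  if h : f.support.Nonempty then f.support.max' h else 0

/-- The `δ`-order: the least index of a nonzero block (`0` for the trivial one). -/
def ordDelta (f : ParamPoly) : ℤ :=
  if h : f.support.Nonempty then f.support.min' h else 0

/-- `Δ(f, g) = (deg_δ g - ord_δ g) - (deg_δ f - ord_δ f)`. -/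
def spanGap (f g : ParamPoly) : ℤ :=
  (degDelta g - ordDelta g) - (degDelta f - ordDelta f)

/-- `δ` is a witness for the instance `(f, g)`: `f_δ` divides `g_δ` in the ring of Laurent
polynomials (the zero polynomial divides only itself). -/
def IsWitness (f g : ParamPoly) (δ : ℤ) : Prop := inst f δ ∣ inst g δ

/-- A witness for which the divisor `f_δ` is moreover nonzero. -/
def IsProperWitness (f g : ParamPoly) (δ : ℤ) : Prop := inst f δ ≠ 0 ∧ inst f δ ∣ inst g δ

/-! ### Piecewise periodic sequences -/

/-- The Laurent polynomial with (non-strict) representation `(D, w)`: the bit string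
`w = a_d … a_D` lists the coefficients by increasing exponent, the last one being that of
`z^D`. -/
def ofBits (D : ℤ) (w : List (ZMod 2)) : Laurent :=
  ∑ k ∈ Finset.range w.length,
    LaurentPolynomial.C (w.getD k 0) * LaurentPolynomial.T (D - w.length + 1 + (k : ℤ))

/-- The prefix of length `k` of the `k`-th power of `w`. -/
def cyclicPrefix (w : List (ZMod 2)) (k : ℕ) : List (ZMod 2) :=
  (List.replicate k w).flatten.take k

/-- The bit string `n_s p_s^(δ-2A-1) ⋯ n_(s+m-1) p_(s+m-1)^(δ-2A-1) n_(s+m)`. -/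
def pwpString (A : ℕ) (s : ℤ) (m : ℕ) (n per : ℤ → List (ZMod 2)) (δ : ℕ) : List (ZMod 2) :=
  ((List.range m).flatMap fun i => n (s + i) ++ cyclicPrefix (per (s + i)) (δ - 2 * A - 1))
    ++ n (s + m)

/-- The sequence `F` is `(A, p)`-piecewise periodic: for all large `δ` the polynomial `F δ` is
represented by the pair `(δ t + A, n_s p_s^(δ-2A-1) ⋯ n_t)`, with fixed bit strings `n_i` of length
`2A+1` and `p_i` of length `p`. Here `t = s + m`. -/
def IsPiecewisePeriodic (A p : ℕ) (F : ℕ → Laurent) : Prop :=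
  ∃ (s : ℤ) (m : ℕ) (n per : ℤ → List (ZMod 2)),
    (∀ i, s ≤ i → i ≤ s + m → (n i).length = 2 * A + 1) ∧
    (∀ i, s ≤ i → i < s + m → (per i).length = p) ∧
    ∃ δ₀ : ℕ, ∀ δ : ℕ, δ₀ ≤ δ → 2 * A + 1 ≤ δ →
      F δ = ofBits ((δ : ℤ) * (s + m) + A) (pwpString A s m n per δ)

/-! ### The division automaton and its period -/

/-- The states of the division-by-`F` automaton: polynomials of degree less than `deg F`. -/
abbrev DivState (F : Polynomial (ZMod 2)) := {h : Polynomial (ZMod 2) // h.degree < F.degree}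

/-- The transition labelled by the bit `b`: it sends `h` to `(h z + b) % F`. -/
def divStep (F : Polynomial (ZMod 2)) (b : ZMod 2) (h : DivState F) : DivState F :=
  ⟨((h : Polynomial (ZMod 2)) * Polynomial.X + Polynomial.C b) % F, by
    have hF : F ≠ 0 := by
      rintro rfl
      exact absurd h.2 (by simp)
    exact EuclideanDomain.mod_lt _ hF⟩

/-- The group generated by the two transitions of the automaton, as permutations of the states
(they are permutations whenever the constant coefficient of `F` is not zero). -/
def divGroup (F : Polynomial (ZMod 2)) : Subgroup (Equiv.Perm (DivState F)) :=
  Subgroup.closure {σ | ∃ b : ZMod 2, ∀ h, σ h = divStep F b h}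

/-- The polynomial `f z^(-ord f)`, whose constant coefficient is not zero if `f ≠ 0`. -/
def shiftPoly (f : Laurent) : Polynomial (ZMod 2) :=
  LaurentPolynomial.trunc (f * LaurentPolynomial.T (-lord f))

/-- The constant `P_f` of a nonzero Laurent polynomial: the order of the transition group of the
division automaton of `f z^(-ord f)`. -/
def period (f : Laurent) : ℕ := Nat.card (divGroup (shiftPoly f))

end LamplighterDiv

end

open scoped Polynomial

noncomputable section

namespace LamplighterDiv

/-! Put `X = z^δ`. Up to a power of `z`, which is a unit, `f_δ` and `g_δ` are the values at `z^δ` of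
fixed polynomials `F`, `G` over the Laurent ring (`toPoly`, `inst_dvd_inst_iff`). Period 1 forces
the coefficients of `F` and `G` to have exponents in `[-A, A]` and `[-B, B]`
(`suppIn_of_isPiecewisePeriodic`).

For large `δ` the shifted coefficients do not overlap, so `F(z^δ)` has span at least `deg F * δ -
2A`. It therefore cannot divide a nonzero `R(z^δ)` with `deg R < deg F` and short coefficients
(`eq_zero_of_eval_dvd`). If `Δ < 0`, this applies to `R = G` and bounds every witness.

If `Δ = D ≥ 0`, pseudo-division gives `lc(F)^(D+1) * G = F * Q + R` with controlled coefficients,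
and one large witness forces `R = 0`. Write `F = c * F'` with `F'` primitive. By Gauss's lemma `G =
F' * h`, and divisibility at `z^δ` becomes `c ∣ h(z^δ)` wherever `F'(z^δ)` is nonzero. Now `c ∣
lc(F) ∣ z^P - 1`, where `P` is the order of the automaton group, so this condition depends only on
`δ` modulo `P`; for `D = 0` the factor `h` is constant and `δ` plays no role
(`eval_dvd_eval_of_modEq`). A large witness can thus be moved to a small positive one. The power
`P^D` is used only through `P ≤ P^D` for `D ≥ 1`.

Negative parameters reduce to positive ones by `δ ↦ -δ`, which exchanges the first and last blocks
of `f`. -/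

/-! ### Supports of Laurent polynomials -/

/-- All exponents that occur in `q` lie in the interval `[a, b]`. -/
def SuppIn (q : Laurent) (a b : ℤ) : Prop := ∀ k, q.coeff k ≠ 0 → a ≤ k ∧ k ≤ b

lemma SuppIn.mono {q : Laurent} {a b a' b' : ℤ} (h : SuppIn q a b) (ha : a' ≤ a) (hb : b ≤ b') :
    SuppIn q a' b' := fun k hk => ⟨ha.trans (h k hk).1, (h k hk).2.trans hb⟩

lemma suppIn_zero (a b : ℤ) : SuppIn 0 a b := fun k hk => by simp at hk

lemma SuppIn.sub {p q : Laurent} {a b : ℤ} (hp : SuppIn p a b) (hq : SuppIn q a b) :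
    SuppIn (p - q) a b := by
  intro k hk
  by_cases h : p.coeff k = 0
  · refine hq k fun h' => hk ?_
    simp [h, h']
  · exact hp k h

lemma suppIn_sum {ι : Type*} (S : Finset ι) (c : ι → Laurent) {a b : ℤ}
    (h : ∀ i ∈ S, SuppIn (c i) a b) : SuppIn (∑ i ∈ S, c i) a b := by
  intro k hk
  rw [AddMonoidAlgebra.coeff_sum, Finsupp.finsetSum_apply] at hk
  obtain ⟨i, hi, hne⟩ := Finset.exists_ne_zero_of_sum_ne_zero hk
  exact h i hi k hne

lemma SuppIn.mul {p q : Laurent} {a b a' b' : ℤ} (hp : SuppIn p a b) (hq : SuppIn q a' b') :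
    SuppIn (p * q) (a + a') (b + b') := by
  intro k hk
  classical
  rw [AddMonoidAlgebra.coeff_mul] at hk
  obtain ⟨i, hi, hne⟩ := Finset.exists_ne_zero_of_sum_ne_zero hk
  obtain ⟨j, hj, hne'⟩ := Finset.exists_ne_zero_of_sum_ne_zero hne
  have h1 := hp i (by simpa using hi)
  have h2 := hq j (by simpa using hj)
  have h3 : i + j = k := by
    by_contra h
    simp [h] at hne'
  omega

lemma coeff_mul_T (q : Laurent) (a k : ℤ) :
    (q * LaurentPolynomial.T a).coeff k = q.coeff (k - a) := by
  have := AddMonoidAlgebra.coeff_mul_single_eq_coeff_mul (x := q) (m := a) (m₁ := k) (r := 1) (k - a)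
    (fun m' _ => by omega)
  rwa [mul_one] at this

lemma SuppIn.mul_T {q : Laurent} {a b : ℤ} (h : SuppIn q a b) (n : ℤ) :
    SuppIn (q * LaurentPolynomial.T n) (a + n) (b + n) := by
  intro k hk
  rw [coeff_mul_T] at hk
  have := h _ hk
  omega

lemma exists_suppIn (q : Laurent) : ∃ K : ℕ, SuppIn q (-K) K := by
  refine ⟨q.coeff.support.sup Int.natAbs, fun k hk => ?_⟩
  have := Finset.le_sup (f := Int.natAbs) (Finsupp.mem_support_iff.2 hk)
  omega

/-- A multiple of a Laurent polynomial of large span cannot have a small nonzero span. -/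
lemma eq_zero_of_dvd {p r : Laurent} {u v a b : ℤ} (hpr : p ∣ r) (hu : p.coeff u ≠ 0)
    (hv : p.coeff v ≠ 0) (hr : SuppIn r a b) (hlt : b - a < v - u) : r = 0 := by
  obtain ⟨q, rfl⟩ := hpr
  by_contra hne
  have hq : q ≠ 0 := right_ne_zero_of_mul hne
  have hqs : q.coeff.support.Nonempty := by
    rw [Finsupp.support_nonempty_iff]
    simpa using hq
  have hps : p.coeff.support.Nonempty := ⟨u, by simpa using hu⟩
  -- The least exponents of the factors add up in only one way, and so do the greatest. Hence both
  -- extreme terms of the product survive, and spans add.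
  have hmin := AddMonoidAlgebra.coeff_mul_add_of_uniqueAdd (f := p) (g := q)
    (a0 := p.coeff.support.min' hps) (b0 := q.coeff.support.min' hqs) (by
      intro x y hx hy hxy
      have := Finset.min'_le _ _ hx
      have := Finset.min'_le _ _ hy
      omega)
  have hmax := AddMonoidAlgebra.coeff_mul_add_of_uniqueAdd (f := p) (g := q)
    (a0 := p.coeff.support.max' hps) (b0 := q.coeff.support.max' hqs) (by
      intro x y hx hy hxy
      have := Finset.le_max' _ _ hx
      have := Finset.le_max' _ _ hy
      omega)
  have h1 := hr _ (by
    rw [hmin]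
    exact mul_ne_zero (Finsupp.mem_support_iff.1 (Finset.min'_mem _ hps))
      (Finsupp.mem_support_iff.1 (Finset.min'_mem _ hqs)))
  have h2 := hr _ (by
    rw [hmax]
    exact mul_ne_zero (Finsupp.mem_support_iff.1 (Finset.max'_mem _ hps))
      (Finsupp.mem_support_iff.1 (Finset.max'_mem _ hqs)))
  have h3 := Finset.min'_le _ u (Finsupp.mem_support_iff.2 hu)
  have h4 := Finset.le_max' _ v (Finsupp.mem_support_iff.2 hv)
  have h5 := Finset.min'_le_max' _ hqs
  omega

/-! ### Sums of separated blocks -/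

/-- Distinct blocks are shifted apart by at least `δ`, too far for another block to reach this
position. The map `e` lets the same statement serve integer block indices and natural polynomial
degrees. -/
lemma coeff_blocks {ι : Type*} (S : Finset ι) (e : ι → ℤ) (he : Function.Injective e)
    (c : ι → Laurent) {R δ : ℤ} (hc : ∀ i, SuppIn (c i) (-R) R) {k : ℤ}
    (hk : |k| + R < δ) {i : ι} (hi : i ∉ S → c i = 0) :
    (∑ j ∈ S, c j * LaurentPolynomial.T (e j * δ)).coeff (e i * δ + k) = (c i).coeff k := by
  rw [AddMonoidAlgebra.coeff_sum, Finsupp.finsetSum_apply, Finset.sum_eq_single i]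
  · rw [coeff_mul_T]
    congr 1
    ring
  · intro j _ hji
    rw [coeff_mul_T]
    by_contra h
    have h1 := hc j _ h
    have h2 := abs_lt.1 (show |k| < δ - R by linarith)
    have h3 : e i * δ + k - e j * δ = (e i - e j) * δ + k := by ring
    rw [h3] at h1
    have h4 : e j ≠ e i := fun h => hji (he h)
    have hδ : 0 < δ := by
      have := abs_nonneg k
      omega
    rcases lt_or_gt_of_ne h4 with h5 | h5
    · nlinarith
    · nlinarith
  · intro h
    simp [hi h]

lemma coeff_inst (f : ParamPoly) {R δ : ℤ} (hf : ∀ i, SuppIn (f i) (-R) R) (i : ℤ) {k : ℤ}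
    (hk : |k| + R < δ) : (inst f δ).coeff (i * δ + k) = (f i).coeff k :=
  coeff_blocks f.support id Function.injective_id f hf hk (by simp)

lemma eval_T (F : Laurent[X]) (δ : ℤ) : F.eval (LaurentPolynomial.T δ) =
    ∑ j ∈ F.support, F.coeff j * LaurentPolynomial.T ((j : ℤ) * δ) := by
  simp [Polynomial.eval_eq_sum, Polynomial.sum_def]

lemma coeff_eval_T (F : Laurent[X]) {R δ : ℤ} (hF : ∀ i, SuppIn (F.coeff i) (-R) R) (i : ℕ) {k : ℤ}
    (hk : |k| + R < δ) :
    (F.eval (LaurentPolynomial.T δ)).coeff ((i : ℤ) * δ + k) = (F.coeff i).coeff k := by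
  rw [eval_T]
  exact coeff_blocks F.support (fun n : ℕ => (n : ℤ)) Nat.cast_injective F.coeff hF hk (by simp)

lemma exists_coeff_ne_zero {q : Laurent} (hq : q ≠ 0) : ∃ k, q.coeff k ≠ 0 := by
  by_contra! h
  exact hq (LaurentPolynomial.ext (by simpa using h))

lemma abs_le_of_suppIn {q : Laurent} {R k : ℤ} (h : SuppIn q (-R) R) (hk : q.coeff k ≠ 0) :
    |k| ≤ R := abs_le.2 (h k hk)

lemma eval_T_ne_zero {F : Laurent[X]} (hF0 : F ≠ 0) {R δ : ℤ}
    (hF : ∀ i, SuppIn (F.coeff i) (-R) R) (hδ : 2 * R < δ) :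
    F.eval (LaurentPolynomial.T δ) ≠ 0 := by
  obtain ⟨k, hk⟩ := exists_coeff_ne_zero (Polynomial.leadingCoeff_ne_zero.2 hF0)
  intro h
  apply hk
  have := abs_le_of_suppIn (hF _) hk
  rw [Polynomial.leadingCoeff, ← coeff_eval_T F hF F.natDegree (δ := δ) (by omega), h]
  simp

lemma suppIn_eval_T (F : Laurent[X]) {R δ : ℤ} {n : ℕ} (hδ : 0 ≤ δ)
    (hF : ∀ i, SuppIn (F.coeff i) (-R) R) (hn : ∀ i, n ≤ i → F.coeff i = 0) :
    SuppIn (F.eval (LaurentPolynomial.T δ)) (-R) ((n - 1 : ℤ) * δ + R) := by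
  rw [eval_T]
  refine suppIn_sum _ _ fun i hi => ((hF i).mul_T _).mono ?_ ?_
  · have : 0 ≤ (i : ℤ) * δ := by positivity
    omega
  · have h1 : i < n := by
      by_contra h
      exact (Polynomial.mem_support_iff.1 hi) (hn i (by omega))
    have h2 : (i : ℤ) ≤ n - 1 := by omega
    nlinarith

/-- If the value of `F` at a large power of `z` divides that of a polynomial of smaller degree,
then the latter is zero. -/
lemma eq_zero_of_eval_dvd {F R : Laurent[X]} {A ρ δ : ℤ} (hF0 : F.coeff 0 ≠ 0)
    (hF : ∀ i, SuppIn (F.coeff i) (-A) A) (hR : ∀ i, SuppIn (R.coeff i) (-ρ) ρ)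
    (hdeg : ∀ i, F.natDegree ≤ i → R.coeff i = 0) (hA : 0 ≤ A) (hρ : 0 ≤ ρ)
    (hδ : 2 * A + 2 * ρ < δ)
    (hdvd : F.eval (LaurentPolynomial.T δ) ∣ R.eval (LaurentPolynomial.T δ)) : R = 0 := by
  by_contra hR0
  have hFne : F ≠ 0 := by
    rintro rfl
    simp at hF0
  apply eval_T_ne_zero hR0 hR (δ := δ) (by omega)
  obtain ⟨k, hk⟩ := exists_coeff_ne_zero hF0
  obtain ⟨l, hl⟩ := exists_coeff_ne_zero (Polynomial.leadingCoeff_ne_zero.2 hFne)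
  have h1 := abs_le_of_suppIn (hF _) hk
  have h2 := abs_le_of_suppIn (hF _) hl
  refine eq_zero_of_dvd hdvd (u := (0 : ℕ) * δ + k) (v := F.natDegree * δ + l) ?_ ?_
    (suppIn_eval_T R (by omega) hR hdeg) ?_
  · rwa [coeff_eval_T F hF 0 (by omega)]
  · rwa [coeff_eval_T F hF _ (by omega)]
  · have := abs_le.1 h1
    have := abs_le.1 h2
    push_cast
    linarith

/-! ### Division over the ring of Laurent polynomials -/

/-- Pseudo-division by `F`, with control of the supports of the coefficients of the remainder. -/
lemma exists_pseudo_division {F : Laurent[X]} {A : ℤ} (hF : ∀ i, SuppIn (F.coeff i) (-A) A)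
    (k : ℕ) : ∀ (G : Laurent[X]) (B : ℤ), (∀ i, SuppIn (G.coeff i) (-B) B) → 0 ≤ A →
      (∀ i, F.natDegree + k ≤ i → G.coeff i = 0) →
      ∃ Q R : Laurent[X], Polynomial.C F.leadingCoeff ^ k * G = F * Q + R ∧
        (∀ i, F.natDegree ≤ i → R.coeff i = 0) ∧
        ∀ i, SuppIn (R.coeff i) (-(B + k * A)) (B + k * A) := by
  induction k with
  | zero =>
    intro G B hG _ hdeg
    exact ⟨0, G, by simp, hdeg, by simpa using hG⟩
  | succ k ih =>
    intro G B hG hA hdeg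
    -- Subtracting `F * g * X^k` from `lc(F) * G` cancels the top coefficient. Both products widen
    -- the coefficient supports by `A`, whence the term `k * A`.
    set g := G.coeff (F.natDegree + k) with hg
    have hcoeff : ∀ i, (Polynomial.C F.leadingCoeff * G - F * Polynomial.C g * Polynomial.X ^ k).coeff i
        = F.leadingCoeff * G.coeff i - if k ≤ i then F.coeff (i - k) * g else 0 := by
      intro i
      simp [Polynomial.coeff_mul_X_pow']
    obtain ⟨Q, R, hQ, hR, hsupp⟩ :=
      ih (Polynomial.C F.leadingCoeff * G - F * Polynomial.C g * Polynomial.X ^ k) (B + A) (by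
        intro i
        rw [hcoeff]
        refine SuppIn.sub (((hF _).mul (hG i)).mono (by omega) (by omega)) ?_
        split_ifs
        · exact ((hF _).mul (hG _)).mono (by omega) (by omega)
        · exact suppIn_zero _ _) hA (by
        intro i hi
        rw [hcoeff, if_pos (by omega)]
        rcases hi.eq_or_lt with rfl | hi
        · rw [← hg, Nat.add_sub_cancel, Polynomial.leadingCoeff, sub_self]
        · rw [hdeg i (by omega), Polynomial.coeff_eq_zero_of_natDegree_lt (by omega)]
          simp)
    refine ⟨Q + Polynomial.C F.leadingCoeff ^ k * Polynomial.C g * Polynomial.X ^ k, R, ?_, hR,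
      fun i => (hsupp i).mono (by push_cast; linarith) (by push_cast; linarith)⟩
    linear_combination hQ

/-- An ideal of a localization is generated by its contraction, here an ideal of the principal ring
of ordinary polynomials. This provides the gcds needed for contents and Gauss's lemma. -/
instance : IsPrincipalIdealRing Laurent where
  principal I := by
    obtain ⟨p, hp⟩ := IsPrincipalIdealRing.principal (I.under (ZMod 2)[X])
    refine ⟨algebraMap (ZMod 2)[X] Laurent p, ?_⟩
    rw [← IsLocalization.map_under (Submonoid.powers (Polynomial.X : (ZMod 2)[X])) Laurent I, hp]
    exact Ideal.map_span (algebraMap (ZMod 2)[X] Laurent) {p} |>.trans (by rw [Set.image_singleton])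

lemma exists_content_factorization (F : Laurent[X]) :
    ∃ (c : Laurent) (F' : Laurent[X]), F = Polynomial.C c * F' ∧ F'.IsPrimitive ∧
      c ∣ F.leadingCoeff := by
  let _ : NormalizedGCDMonoid Laurent := Nonempty.some inferInstance
  exact ⟨F.content, F.primPart, F.eq_C_content_mul_primPart, F.isPrimitive_primPart,
    Polynomial.content_dvd_coeff _⟩

/-- The constant `a` becomes a unit over the fraction field, and Gauss's lemma brings the
divisibility back down because `F` is primitive. -/
lemma dvd_of_isPrimitive_of_dvd_C_mul {F G : Laurent[X]} (hF : F.IsPrimitive) {a : Laurent}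
    (ha : a ≠ 0) (h : F ∣ Polynomial.C a * G) : F ∣ G := by
  rw [hF.dvd_iff_fraction_map_dvd_fraction_map (FractionRing Laurent)]
  have h' := Polynomial.map_dvd (algebraMap Laurent (FractionRing Laurent)) h
  rw [Polynomial.map_mul, Polynomial.map_C] at h'
  refine (IsUnit.dvd_mul_left ?_).1 h'
  rw [Polynomial.isUnit_C, isUnit_iff_ne_zero]
  simpa using ha

/-! ### Powers of `z` modulo a divisor of `z ^ P - 1` -/

lemma dvd_T_mul_sub_one {c : Laurent} {P : ℤ} (h : c ∣ LaurentPolynomial.T P - 1) (k : ℤ) :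
    c ∣ LaurentPolynomial.T (P * k) - 1 := by
  have hnat : ∀ n : ℕ, c ∣ LaurentPolynomial.T (P * n) - 1 := fun n => by
    have := h.trans (sub_one_dvd_pow_sub_one (LaurentPolynomial.T P : Laurent) n)
    rwa [LaurentPolynomial.T_pow, mul_comm (n : ℤ)] at this
  obtain ⟨n, rfl | rfl⟩ := k.eq_nat_or_neg
  · exact hnat n
  · have h1 : (LaurentPolynomial.T (P * -(n : ℤ)) - 1 : Laurent) =
        (LaurentPolynomial.T (P * n) - 1) * -LaurentPolynomial.T (P * -(n : ℤ)) := by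
      have : (LaurentPolynomial.T (P * n) : Laurent) * LaurentPolynomial.T (P * -(n : ℤ)) = 1 := by
        rw [← LaurentPolynomial.T_add, ← LaurentPolynomial.T_zero]
        congr 1
        ring
      linear_combination this
    rw [h1]
    exact (hnat n).mul_right _

lemma dvd_T_sub_T {c : Laurent} {P δ δ' : ℤ} (h : c ∣ LaurentPolynomial.T P - 1)
    (hδ : P ∣ δ' - δ) : c ∣ LaurentPolynomial.T δ' - LaurentPolynomial.T δ := by
  obtain ⟨k, hk⟩ := hδ
  have h1 : (LaurentPolynomial.T δ' - LaurentPolynomial.T δ : Laurent) =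
      (LaurentPolynomial.T (P * k) - 1) * LaurentPolynomial.T δ := by
    rw [sub_mul, ← LaurentPolynomial.T_add, one_mul, ← hk, sub_add_cancel]
  rw [h1]
  exact (dvd_T_mul_sub_one h k).mul_right _

/-- Divisibility at one large power of `z` propagates along a residue class. -/
theorem eval_dvd_eval_of_modEq {F G : Laurent[X]} {A B δ δ' P : ℤ} {D : ℕ} (hF0 : F.coeff 0 ≠ 0)
    (hF : ∀ i, SuppIn (F.coeff i) (-A) A) (hG : ∀ i, SuppIn (G.coeff i) (-B) B)
    (hA : 0 ≤ A) (hB : 0 ≤ B) (hdeg : ∀ i, F.natDegree + D < i → G.coeff i = 0)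
    (hδ : 2 * A + 2 * (B + (D + 1) * A) < δ) (hP : F.leadingCoeff ∣ LaurentPolynomial.T P - 1)
    (hdvd : F.eval (LaurentPolynomial.T δ) ∣ G.eval (LaurentPolynomial.T δ))
    (hδ' : D = 0 ∨ P ∣ δ' - δ) :
    F.eval (LaurentPolynomial.T δ') ∣ G.eval (LaurentPolynomial.T δ') := by
  have hFne : F ≠ 0 := by
    rintro rfl
    simp at hF0
  obtain ⟨Q, R, hQ, hR, hsupp⟩ := exists_pseudo_division hF (D + 1) G B hG hA
    (fun i hi => hdeg i (by omega))
  have hR0 : R = 0 := by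
    refine eq_zero_of_eval_dvd hF0 hF hsupp hR hA (by positivity)
      (by push_cast; linarith) ?_
    have h1 := congrArg (Polynomial.eval (LaurentPolynomial.T δ : Laurent)) hQ
    simp only [Polynomial.eval_mul, Polynomial.eval_add] at h1
    exact (dvd_add_right (Dvd.intro _ rfl)).1 (h1 ▸ hdvd.mul_left _)
  obtain ⟨c, F', rfl, hprim, hc⟩ := exists_content_factorization F
  have hlead := Polynomial.leadingCoeff_ne_zero.2 hFne
  obtain ⟨h, rfl⟩ : F' ∣ G := by
    refine dvd_of_isPrimitive_of_dvd_C_mul hprim (pow_ne_zero (D + 1) hlead) ?_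
    rw [Polynomial.C_pow, hQ, hR0, add_zero]
    exact (dvd_mul_left F' _).mul_right Q
  -- Nonvanishing is needed only at the known witness, to cancel `F'` there; at `δ'` the factor is
  -- merely multiplied back.
  have hF'δ : F'.eval (LaurentPolynomial.T δ) ≠ 0 := by
    intro h0
    refine eval_T_ne_zero hFne hF (δ := δ) (by nlinarith [mul_nonneg (Nat.cast_nonneg (α := ℤ) D) hA]) ?_
    rw [Polynomial.eval_mul, h0, mul_zero]
  simp only [Polynomial.eval_mul, Polynomial.eval_C] at hdvd ⊢
  rw [mul_comm c, mul_dvd_mul_iff_left hF'δ] at hdvd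
  rw [mul_comm c]
  refine mul_dvd_mul_left _ ?_
  rcases hδ' with rfl | hδ'
  · have hdeg0 : h.natDegree = 0 := by
      by_cases h0 : h = 0
      · simp [h0]
      have h1 : (F' * h).natDegree ≤ F'.natDegree := by
        rw [Polynomial.natDegree_le_iff_coeff_eq_zero]
        intro i hi
        refine hdeg i ?_
        have := Polynomial.natDegree_C_mul_le c F'
        omega
      rw [Polynomial.natDegree_mul hprim.ne_zero h0] at h1
      omega
    rw [Polynomial.eq_C_of_natDegree_eq_zero hdeg0, Polynomial.eval_C] at hdvd ⊢
    exact hdvd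
  · have h1 := (dvd_T_sub_T (hc.trans hP) hδ').trans
      (Polynomial.sub_dvd_eval_sub (LaurentPolynomial.T δ') (LaurentPolynomial.T δ) h)
    exact (dvd_iff_dvd_of_dvd_sub h1).2 hdvd

/-! ### Periodic sequences of parametric polynomials -/

lemma cyclicPrefix_singleton (b : ZMod 2) (k : ℕ) : cyclicPrefix [b] k = List.replicate k b := by
  simp [cyclicPrefix]

lemma length_flatMap_range {α : Type*} (g : ℕ → List α) {L : ℕ} (m : ℕ)
    (hg : ∀ i < m, (g i).length = L) : ((List.range m).flatMap g).length = m * L := by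
  induction m with
  | zero => simp
  | succ m ih =>
    rw [List.range_succ, List.flatMap_append, List.length_append, ih fun i hi => hg i (by omega)]
    simp [hg m (by omega), Nat.succ_mul]

lemma getD_flatMap_range {α : Type*} (g : ℕ → List α) {L : ℕ} (d : α) (m : ℕ)
    (hg : ∀ i < m, (g i).length = L) {j r : ℕ} (hj : j < m) (hr : r < L) :
    ((List.range m).flatMap g).getD (j * L + r) d = (g j).getD r d := by
  induction m with
  | zero => omega
  | succ m ih =>
    have hlen := length_flatMap_range g m fun i hi => hg i (by omega)
    rw [List.range_succ, List.flatMap_append]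
    rcases Nat.lt_succ_iff_lt_or_eq.1 hj with hj | rfl
    · rw [List.getD_append _ _ _ _ (by
        rw [hlen]
        calc j * L + r < j * L + L := by omega
          _ = (j + 1) * L := by ring
          _ ≤ m * L := Nat.mul_le_mul_right _ hj)]
      exact ih (fun i hi => hg i (by omega)) hj
    · rw [List.getD_append_right _ _ _ _ (by omega), hlen]
      simp

lemma coeff_ofBits (D : ℤ) (w : List (ZMod 2)) (k : ℕ) (hk : k < w.length) :
    (ofBits D w).coeff (D - w.length + 1 + k) = w.getD k 0 := by
  rw [ofBits, AddMonoidAlgebra.coeff_sum, Finsupp.finsetSum_apply, Finset.sum_eq_single k]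
  · rw [coeff_mul_T, sub_self]
    simp
  · intro j _ hj
    rw [coeff_mul_T, LaurentPolynomial.C_apply, if_neg (by omega)]
  · simp [hk]

lemma suppIn_C (a : ZMod 2) : SuppIn (LaurentPolynomial.C a) 0 0 := by
  intro k hk
  rw [LaurentPolynomial.C_apply] at hk
  split_ifs at hk with h
  · omega
  · exact absurd rfl hk

lemma suppIn_ofBits (D : ℤ) (w : List (ZMod 2)) :
    SuppIn (ofBits D w) (D - w.length + 1) D := by
  refine suppIn_sum _ _ fun k hk => ((suppIn_C _).mul_T _).mono ?_ ?_
  all_goals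
    have := Finset.mem_range.1 hk
    omega

section

variable {A m : ℕ} {s : ℤ} {n per : ℤ → List (ZMod 2)}

/-- The cast of the indices to integers is a nested `flatMap` in the definition; here it is
absorbed, so that the index is a natural number. -/
lemma pwpString_eq (δ : ℕ) : pwpString A s m n per δ =
    ((List.range m).flatMap fun i : ℕ =>
      n (s + i) ++ cyclicPrefix (per (s + i)) (δ - 2 * A - 1)) ++ n (s + m) := by
  rw [pwpString]
  congr 1
  exact List.flatMap_assoc.trans (by simp)

lemma length_block (hn : ∀ i, s ≤ i → i ≤ s + m → (n i).length = 2 * A + 1)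
    (hper : ∀ i, s ≤ i → i < s + m → (per i).length = 1) {δ : ℕ} (hδ : 2 * A + 1 ≤ δ) (i : ℕ)
    (hi : i < m) :
    (n (s + i) ++ cyclicPrefix (per (s + i)) (δ - 2 * A - 1)).length = δ := by
  obtain ⟨b, hb⟩ := List.length_eq_one_iff.1 (hper (s + i) (by omega) (by omega))
  rw [hb, cyclicPrefix_singleton, List.length_append, hn _ (by omega) (by omega),
    List.length_replicate]
  omega

lemma length_pwpString (hn : ∀ i, s ≤ i → i ≤ s + m → (n i).length = 2 * A + 1)
    (hper : ∀ i, s ≤ i → i < s + m → (per i).length = 1) {δ : ℕ} (hδ : 2 * A + 1 ≤ δ) :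
    (pwpString A s m n per δ).length = m * δ + (2 * A + 1) := by
  rw [pwpString_eq, List.length_append, length_flatMap_range _ m (length_block hn hper hδ),
    hn _ (by omega) (by omega)]

lemma getD_pwpString (hn : ∀ i, s ≤ i → i ≤ s + m → (n i).length = 2 * A + 1)
    (hper : ∀ i, s ≤ i → i < s + m → (per i).length = 1) {δ : ℕ} (hδ : 2 * A + 1 ≤ δ)
    {j r : ℕ} (hj : j < m) (hr : 2 * A < r) (hrδ : r < δ) :
    (pwpString A s m n per δ).getD (j * δ + r) 0 = (per (s + j)).getD 0 0 := by
  have hlen := length_block hn hper hδ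
  rw [pwpString_eq, List.getD_append _ _ _ _ (by
      rw [length_flatMap_range _ m hlen]
      calc j * δ + r < j * δ + δ := by omega
        _ = (j + 1) * δ := by ring
        _ ≤ m * δ := Nat.mul_le_mul_right _ hj),
    getD_flatMap_range _ 0 m hlen hj hrδ]
  obtain ⟨b, hb⟩ := List.length_eq_one_iff.1 (hper (s + j) (by omega) (by omega))
  have hnj := hn (s + j) (by omega) (by omega)
  rw [hb, cyclicPrefix_singleton, List.getD_append_right _ _ _ _ (by omega), hnj,
    List.getD_replicate _ (show r - (2 * A + 1) < δ - 2 * A - 1 by omega)]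
  rfl

end

/-- The blocks of a parametric polynomial whose values form an `(A, 1)`-periodic sequence have
their exponents between `-A` and `A`. -/
theorem suppIn_of_isPiecewisePeriodic {f : ParamPoly} {A : ℕ}
    (h : IsPiecewisePeriodic A 1 fun δ : ℕ => inst f (δ : ℤ)) (i : ℤ) : SuppIn (f i) (-A) A := by
  obtain ⟨s, m, n, per, hn, hper, δ₀, hδ₀⟩ := h
  obtain ⟨K, hK⟩ : ∃ K : ℕ, ∀ i, SuppIn (f i) (-K) K := by
    choose K hK using fun i => exists_suppIn (f i)
    refine ⟨f.support.sup K, fun i => ?_⟩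
    by_cases hi : f i = 0
    · rw [hi]
      exact suppIn_zero _ _
    · have := Finset.le_sup (f := K) (Finsupp.mem_support_iff.2 hi)
      exact (hK i).mono (by omega) (by omega)
  -- Large enough that the offset `A + K + 1` from a block centre lies in the gap after it and out
  -- of reach of every block.
  set δ : ℕ := δ₀ + 2 * A + 2 * K + 2 with hδ
  have hF := hδ₀ δ (by omega) (by omega)
  have hlen := length_pwpString (s := s) hn hper (show 2 * A + 1 ≤ δ by omega)
  set w := pwpString A s m n per δ
  set E : ℤ := (δ : ℤ) * (s + m) + A
  have hstart : E - w.length + 1 = s * δ - A := by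
    rw [hlen]
    simp only [E]
    push_cast
    ring
  have hgap : ∀ j : ℕ, j < m → ∀ r : ℕ, 2 * A < r → r < δ →
      (inst f δ).coeff ((s + j) * δ + (r - A)) = (per (s + j)).getD 0 0 := by
    intro j hj r hr hrδ
    have hlt : j * δ + r < w.length := by
      rw [hlen]
      calc j * δ + r < j * δ + δ := by omega
        _ = (j + 1) * δ := by ring
        _ ≤ m * δ := Nat.mul_le_mul_right _ hj
        _ ≤ _ := by omega
    rw [← getD_pwpString hn hper (by omega) hj hr hrδ, ← coeff_ofBits E w _ hlt, hstart]
    have := hF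
    simp only at this
    rw [this]
    congr 1
    push_cast
    ring
  -- A gap repeats a single bit, so one position known to carry a zero clears the whole gap.
  have hper0 : ∀ j : ℕ, j < m → (per (s + j)).getD 0 0 = 0 := by
    intro j hj
    rw [← hgap j hj (2 * A + K + 1) (by omega) (by omega)]
    have h1 := coeff_inst f hK (s + j) (δ := δ) (k := A + K + 1)
      (by rw [abs_of_nonneg (by positivity)]; omega)
    rw [show (((2 * A + K + 1 : ℕ) : ℤ) - A) = A + K + 1 by push_cast; ring, h1]
    by_contra h2
    have := hK _ _ h2
    omega
  intro k hk
  have hkK := hK i k hk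
  by_contra hkA
  have habs : |k| ≤ K := abs_le.2 hkK
  rw [← coeff_inst f hK i (δ := δ) (by omega)] at hk
  have hrange : s * δ - A ≤ i * δ + k ∧ i * δ + k ≤ E := by
    have h1 := suppIn_ofBits E w (i * δ + k) (by
      have := hF
      simp only at this
      rwa [← this])
    rwa [hstart] at h1
  have hE : E = (s + m) * δ + A := by simp only [E]; ring
  rw [hE] at hrange
  have hδpos : (0 : ℤ) < δ := by omega
  -- An exponent above `A` falls in the gap after block `i`, one below `-A` in the gap before it.
  -- The range of the represented string ensures that this gap is one of the `m` listed.
  obtain ⟨j, r, hj, hr, hrδ, heq⟩ : ∃ j r : ℕ, j < m ∧ 2 * A < r ∧ r < δ ∧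
      i * δ + k = (s + j) * δ + ((r : ℤ) - A) := by
    rcases lt_or_ge (A : ℤ) k with hAk | hAk
    · have h1 : s ≤ i := by
        by_contra h
        have : i + 1 ≤ s := by omega
        nlinarith
      have h2 : i < s + m := by
        by_contra h
        have : s + m ≤ i := by omega
        nlinarith
      refine ⟨(i - s).toNat, (k + A).toNat, by omega, by omega, by omega, ?_⟩
      rw [Int.toNat_of_nonneg (by omega), Int.toNat_of_nonneg (by omega)]
      ring
    · have h0 : k < -A := by omega
      have h1 : s + 1 ≤ i := by
        by_contra h
        have : i ≤ s := by omega
        nlinarith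
      have h2 : i ≤ s + m := by
        by_contra h
        have : s + m + 1 ≤ i := by omega
        nlinarith
      refine ⟨(i - 1 - s).toNat, (δ + k + A).toNat, by omega, by omega, by omega, ?_⟩
      rw [Int.toNat_of_nonneg (by omega), Int.toNat_of_nonneg (by omega)]
      ring
  rw [heq, hgap j hj r hr hrδ, hper0 j hj] at hk
  exact hk rfl

/-! ### The period of the division automaton -/

instance finite_divState (F : (ZMod 2)[X]) : Finite (DivState F) := by
  refine Finite.of_injective (β := Fin F.natDegree → ZMod 2)
    (fun h i => (h : (ZMod 2)[X]).coeff i) fun h h' heq => Subtype.ext (Polynomial.ext fun n => ?_)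
  by_cases hn : n < F.natDegree
  · exact congrFun heq ⟨n, hn⟩
  · have hdeg : ∀ g : DivState F, (g : (ZMod 2)[X]).coeff n = 0 := fun g => by
      refine Polynomial.coeff_eq_zero_of_degree_lt (g.2.trans_le ?_)
      exact Polynomial.degree_le_natDegree.trans (by exact_mod_cast not_lt.1 hn)
    rw [hdeg, hdeg]

lemma period_pos (f : Laurent) : 0 < period f := Nat.card_pos

/-- `F` divides `X ^ P - 1`, where `P` is the order of the transition group of the division
automaton of `F`. -/
lemma dvd_X_pow_card_sub_one {F : (ZMod 2)[X]} (hF : F.coeff 0 ≠ 0) :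
    F ∣ Polynomial.X ^ Nat.card (divGroup F) - 1 := by
  -- For a unit `F` the polynomial `1`, whose orbit is followed below, is not a state.
  by_cases hu : IsUnit F
  · exact hu.dvd
  have hF0 : F ≠ 0 := by
    rintro rfl
    simp at hF
  have hcop : IsCoprime F Polynomial.X := by
    rw [isCoprime_comm, Polynomial.irreducible_X.coprime_iff_not_dvd, Polynomial.X_dvd_iff]
    exact hF
  have hmod : ∀ p : (ZMod 2)[X], F ∣ p % F - p := fun p =>
    ⟨-(p / F), by linear_combination EuclideanDomain.mod_add_div p F⟩
  have hinj : Function.Injective (divStep F 0) := by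
    intro h h' heq
    have h1 : (((h : (ZMod 2)[X]) * Polynomial.X + Polynomial.C 0) % F) =
        (((h' : (ZMod 2)[X]) * Polynomial.X + Polynomial.C 0) % F) := congrArg Subtype.val heq
    have h2 : F ∣ ((h : (ZMod 2)[X]) - (h' : (ZMod 2)[X])) * Polynomial.X := by
      have h3 := dvd_sub (hmod ((h' : (ZMod 2)[X]) * Polynomial.X + Polynomial.C 0))
        (hmod ((h : (ZMod 2)[X]) * Polynomial.X + Polynomial.C 0))
      rw [h1] at h3
      convert h3 using 1
      ring
    have h3 : F ∣ (h : (ZMod 2)[X]) - (h' : (ZMod 2)[X]) := hcop.dvd_of_dvd_mul_right h2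
    have h4 := Polynomial.eq_zero_of_dvd_of_degree_lt h3
      ((Polynomial.degree_sub_le _ _).trans_lt (max_lt h.2 h'.2))
    exact Subtype.ext (sub_eq_zero.1 h4)
  let σ : Equiv.Perm (DivState F) :=
    Equiv.ofBijective (divStep F 0) (Finite.injective_iff_bijective.1 hinj)
  have hσ : σ ∈ divGroup F := Subgroup.subset_closure ⟨0, fun _ => rfl⟩
  have hpow : ∀ (k : ℕ) (h : DivState F),
      F ∣ ((σ ^ k) h : (ZMod 2)[X]) - (h : (ZMod 2)[X]) * Polynomial.X ^ k := by
    intro k h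
    induction k with
    | zero => simp
    | succ k ih =>
      rw [pow_succ', Equiv.Perm.mul_apply]
      have h1 := hmod (((σ ^ k) h : (ZMod 2)[X]) * Polynomial.X + Polynomial.C 0)
      have h2 := dvd_add h1 (ih.mul_right Polynomial.X)
      change F ∣ (((σ ^ k) h : (ZMod 2)[X]) * Polynomial.X + Polynomial.C 0) % F - _
      convert h2 using 1
      rw [Polynomial.C_0]
      ring
  -- The transition `σ` is multiplication by `X` modulo `F`. By Lagrange its power `P` is trivial,
  -- and evaluating at the state `1` gives `X^P ≡ 1`.
  have hone : σ ^ Nat.card (divGroup F) = 1 := by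
    have := congrArg Subtype.val (pow_card_eq_one' (x := (⟨σ, hσ⟩ : divGroup F)))
    exact this
  have hdeg : (1 : (ZMod 2)[X]).degree < F.degree := by
    rw [Polynomial.degree_one]
    exact Polynomial.degree_pos_of_ne_zero_of_nonunit hF0 hu
  have h1 := hpow (Nat.card (divGroup F)) ⟨1, hdeg⟩
  rw [hone, Equiv.Perm.one_apply] at h1
  rw [dvd_sub_comm]
  simpa using h1

lemma lord_le {f : Laurent} {k : ℤ} (hk : f.coeff k ≠ 0) : lord f ≤ k := by
  have h : k ∈ f.coeff.support := Finsupp.mem_support_iff.2 hk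
  rw [lord, dif_pos ⟨k, h⟩]
  exact Finset.min'_le _ _ h

lemma coeff_lord_ne_zero {f : Laurent} (hf : f ≠ 0) : f.coeff (lord f) ≠ 0 := by
  obtain ⟨k, hk⟩ := exists_coeff_ne_zero hf
  have h : f.coeff.support.Nonempty := ⟨k, Finsupp.mem_support_iff.2 hk⟩
  rw [lord, dif_pos h]
  exact Finsupp.mem_support_iff.1 (Finset.min'_mem _ h)

lemma coeff_toLaurent_natCast (p : (ZMod 2)[X]) (n : ℕ) :
    (Polynomial.toLaurent p).coeff (n : ℤ) = p.coeff n := by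
  rw [LaurentPolynomial.coeff_toLaurent]
  exact Finsupp.mapDomain_apply Nat.cast_injective _ _

lemma exists_toLaurent_eq {q : Laurent} (hq : ∀ k, q.coeff k ≠ 0 → 0 ≤ k) :
    ∃ p : (ZMod 2)[X], Polynomial.toLaurent p = q := by
  refine ⟨∑ k ∈ q.coeff.support, Polynomial.C (q.coeff k) * Polynomial.X ^ k.toNat, ?_⟩
  conv_rhs => rw [← AddMonoidAlgebra.sum_coeff_single q]
  rw [map_sum, Finsupp.sum]
  refine Finset.sum_congr rfl fun k hk => ?_
  rw [Polynomial.toLaurent_C_mul_X_pow, LaurentPolynomial.single_eq_C_mul_T,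
    Int.toNat_of_nonneg (hq k (Finsupp.mem_support_iff.1 hk))]

lemma toLaurent_shiftPoly (f : Laurent) :
    Polynomial.toLaurent (shiftPoly f) = f * LaurentPolynomial.T (-lord f) := by
  obtain ⟨p, hp⟩ := exists_toLaurent_eq (q := f * LaurentPolynomial.T (-lord f)) fun k hk => by
    rw [coeff_mul_T] at hk
    have := lord_le hk
    omega
  rw [shiftPoly, ← hp, Polynomial.trunc_toLaurent]

/-- Shifting by `lord f` makes the constant coefficient nonzero, as the automaton argument requires,
and changes `f` only by a unit. -/
lemma dvd_T_period_sub_one {f : Laurent} (hf : f ≠ 0) :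
    f ∣ LaurentPolynomial.T (period f) - 1 := by
  have hshift := toLaurent_shiftPoly f
  have h0 : (shiftPoly f).coeff 0 ≠ 0 := by
    rw [← coeff_toLaurent_natCast, hshift, coeff_mul_T]
    simpa using coeff_lord_ne_zero hf
  have h1 := map_dvd (Polynomial.toLaurent (R := ZMod 2)) (dvd_X_pow_card_sub_one h0)
  rw [hshift, map_sub, map_one, Polynomial.toLaurent_X_pow] at h1
  exact (dvd_mul_right _ _).trans h1

/-! ### Parametric polynomials as polynomials over the Laurent polynomials -/

lemma ordDelta_eq {f : ParamPoly} {s : ℤ} (hs : f s ≠ 0) (hle : ∀ i, f i ≠ 0 → s ≤ i) :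
    ordDelta f = s := by
  have h : f.support.Nonempty := ⟨s, Finsupp.mem_support_iff.2 hs⟩
  rw [ordDelta, dif_pos h]
  exact le_antisymm (Finset.min'_le _ _ (Finsupp.mem_support_iff.2 hs))
    (hle _ (Finsupp.mem_support_iff.1 (Finset.min'_mem _ h)))

lemma degDelta_eq {f : ParamPoly} {t : ℤ} (ht : f t ≠ 0) (hle : ∀ i, f i ≠ 0 → i ≤ t) :
    degDelta f = t := by
  have h : f.support.Nonempty := ⟨t, Finsupp.mem_support_iff.2 ht⟩
  rw [degDelta, dif_pos h]
  exact le_antisymm (hle _ (Finsupp.mem_support_iff.1 (Finset.max'_mem _ h)))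
    (Finset.le_max' _ _ (Finsupp.mem_support_iff.2 ht))

lemma ordDelta_le {f : ParamPoly} {i : ℤ} (hi : f i ≠ 0) : ordDelta f ≤ i := by
  have h : i ∈ f.support := Finsupp.mem_support_iff.2 hi
  rw [ordDelta, dif_pos ⟨i, h⟩]
  exact Finset.min'_le _ _ h

lemma le_degDelta {f : ParamPoly} {i : ℤ} (hi : f i ≠ 0) : i ≤ degDelta f := by
  have h : i ∈ f.support := Finsupp.mem_support_iff.2 hi
  rw [degDelta, dif_pos ⟨i, h⟩]
  exact Finset.le_max' _ _ h

lemma apply_ordDelta_ne_zero {f : ParamPoly} (hf : f ≠ 0) : f (ordDelta f) ≠ 0 := by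
  have h := Finsupp.support_nonempty_iff.2 hf
  rw [ordDelta, dif_pos h]
  exact Finsupp.mem_support_iff.1 (Finset.min'_mem _ h)

lemma apply_degDelta_ne_zero {f : ParamPoly} (hf : f ≠ 0) : f (degDelta f) ≠ 0 := by
  have h := Finsupp.support_nonempty_iff.2 hf
  rw [degDelta, dif_pos h]
  exact Finsupp.mem_support_iff.1 (Finset.max'_mem _ h)

/-- The polynomial `∑ᵢ f_(i + ord f) Xⁱ`. -/
def toPoly (f : ParamPoly) : Laurent[X] :=
  ∑ i ∈ f.support, Polynomial.C (f i) * Polynomial.X ^ (i - ordDelta f).toNat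

lemma coeff_toPoly (f : ParamPoly) (n : ℕ) : (toPoly f).coeff n = f (ordDelta f + n) := by
  have h : ∀ i ∈ f.support, (Polynomial.C (f i) * Polynomial.X ^ (i - ordDelta f).toNat).coeff n =
      if i = ordDelta f + n then f i else 0 := by
    intro i hi
    have := ordDelta_le (Finsupp.mem_support_iff.1 hi)
    rw [Polynomial.coeff_C_mul_X_pow]
    congr 1
    rw [eq_iff_iff]
    omega
  rw [toPoly, Polynomial.finsetSum_coeff, Finset.sum_congr rfl h, Finset.sum_ite_eq']
  split_ifs with h'
  · rfl
  · exact (Finsupp.notMem_support_iff.1 h').symm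

lemma inst_eq (f : ParamPoly) (δ : ℤ) : inst f δ =
    LaurentPolynomial.T (ordDelta f * δ) * (toPoly f).eval (LaurentPolynomial.T δ) := by
  rw [inst, Finsupp.sum, toPoly, Polynomial.eval_finsetSum, Finset.mul_sum]
  refine Finset.sum_congr rfl fun i hi => ?_
  have := ordDelta_le (Finsupp.mem_support_iff.1 hi)
  rw [Polynomial.eval_mul, Polynomial.eval_C, Polynomial.eval_pow, Polynomial.eval_X,
    LaurentPolynomial.T_pow, mul_left_comm, ← LaurentPolynomial.T_add,
    Int.toNat_of_nonneg (by omega)]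
  congr 2
  ring

lemma inst_dvd_inst_iff (f g : ParamPoly) (δ : ℤ) : inst f δ ∣ inst g δ ↔
    (toPoly f).eval (LaurentPolynomial.T δ) ∣ (toPoly g).eval (LaurentPolynomial.T δ) := by
  rw [inst_eq, inst_eq, (LaurentPolynomial.isUnit_T _).mul_left_dvd,
    (LaurentPolynomial.isUnit_T _).dvd_mul_left]

lemma toPoly_ne_zero {f : ParamPoly} (hf : f ≠ 0) : toPoly f ≠ 0 := by
  intro h
  have := coeff_toPoly f 0
  rw [h] at this
  exact apply_ordDelta_ne_zero hf (by simpa using this.symm)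

lemma natDegree_toPoly {f : ParamPoly} (hf : f ≠ 0) :
    ((toPoly f).natDegree : ℤ) = degDelta f - ordDelta f := by
  have hle := ordDelta_le (apply_degDelta_ne_zero hf)
  have h : (toPoly f).natDegree = (degDelta f - ordDelta f).toNat := by
    refine Polynomial.natDegree_eq_of_le_of_coeff_ne_zero ?_ ?_
    · rw [Polynomial.natDegree_le_iff_coeff_eq_zero]
      intro n hn
      rw [coeff_toPoly]
      by_contra hne
      have := le_degDelta hne
      omega
    · rw [coeff_toPoly, Int.toNat_of_nonneg (by omega), add_sub_cancel]
      exact apply_degDelta_ne_zero hf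
  rw [h, Int.toNat_of_nonneg (by omega)]

lemma leadingCoeff_toPoly {f : ParamPoly} (hf : f ≠ 0) :
    (toPoly f).leadingCoeff = f (degDelta f) := by
  rw [Polynomial.leadingCoeff, coeff_toPoly, natDegree_toPoly hf, add_sub_cancel]

lemma coeff_toPoly_eq_zero {f : ParamPoly} {n : ℕ} (hn : degDelta f - ordDelta f < n) :
    (toPoly f).coeff n = 0 := by
  rw [coeff_toPoly]
  by_contra hne
  have := le_degDelta hne
  omega

/-! ### Witnesses -/

lemma inst_ne_zero {f : ParamPoly} (hf : f ≠ 0) {A δ : ℤ} (hA : ∀ i, SuppIn (f i) (-A) A)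
    (hδ : 2 * A < δ) : inst f δ ≠ 0 := by
  rw [inst_eq]
  refine mul_ne_zero (LaurentPolynomial.isUnit_T _).ne_zero
    (eval_T_ne_zero (toPoly_ne_zero hf) (fun i => ?_) hδ)
  rw [coeff_toPoly]
  exact hA _

/-- If the `δ`-span of `f` exceeds that of `g`, all witnesses are small. -/
theorem le_of_inst_dvd {f g : ParamPoly} (hf : f ≠ 0) (hg : g ≠ 0) {A B : ℕ}
    (hA : ∀ i, SuppIn (f i) (-A) A) (hB : ∀ i, SuppIn (g i) (-B) B) (hgap : spanGap f g < 0)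
    {δ : ℤ} (hδ : inst f δ ∣ inst g δ) : δ ≤ 2 * B + 2 * A := by
  by_contra! hlt
  rw [spanGap] at hgap
  refine toPoly_ne_zero hg (eq_zero_of_eval_dvd (F := toPoly f) (A := A) (ρ := B) (δ := δ) ?_ ?_ ?_
    ?_ (by positivity) (by positivity) (by linarith) ((inst_dvd_inst_iff f g δ).1 hδ))
  · rw [coeff_toPoly]
    simpa using apply_ordDelta_ne_zero hf
  · intro i
    rw [coeff_toPoly]
    exact hA _
  · intro i
    rw [coeff_toPoly]
    exact hB _
  · intro i hi
    refine coeff_toPoly_eq_zero ?_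
    have := natDegree_toPoly hf
    omega

/-- A large witness yields a small positive one. -/
theorem exists_small_witness {f g : ParamPoly} (hf : f ≠ 0) {A B D : ℕ}
    (hA : ∀ i, SuppIn (f i) (-A) A) (hB : ∀ i, SuppIn (g i) (-B) B) (hgap : spanGap f g = D)
    {δ : ℤ} (hδ : inst f δ ∣ inst g δ)
    (hlt : (period (f (degDelta f)) : ℤ) ^ D + 2 * ((B : ℤ) + 4 * A * D) + 4 * A + 1 < δ) :
    ∃ δ' : ℤ, IsProperWitness f g δ' ∧ 0 ≤ δ' ∧
      δ' ≤ (period (f (degDelta f)) : ℤ) ^ D + 2 * ((B : ℤ) + 4 * A * D) + 4 * A + 1 := by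
  set P : ℤ := (period (f (degDelta f)) : ℤ) with hPdef
  have hP : 0 < P := Int.natCast_pos.2 (period_pos _)
  have hAD : 0 ≤ (A : ℤ) * D := by positivity
  have hPD : 0 < P ^ D := pow_pos hP D
  have key : ∀ δ' : ℤ, (D = 0 ∨ P ∣ δ' - δ) → inst f δ' ∣ inst g δ' := by
    intro δ' hδ'
    rw [inst_dvd_inst_iff] at hδ ⊢
    refine eval_dvd_eval_of_modEq (A := A) (B := B) (D := D) (δ := δ) (P := P) ?_ ?_ ?_
      (by positivity) (by positivity) ?_ (by linarith) ?_ hδ hδ'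
    · rw [coeff_toPoly]
      simpa using apply_ordDelta_ne_zero hf
    · intro i
      rw [coeff_toPoly]
      exact hA _
    · intro i
      rw [coeff_toPoly]
      exact hB _
    · intro i hi
      refine coeff_toPoly_eq_zero ?_
      have := natDegree_toPoly hf
      rw [spanGap] at hgap
      omega
    · rw [leadingCoeff_toPoly hf]
      exact dvd_T_period_sub_one (apply_degDelta_ne_zero hf)
  rcases Nat.eq_zero_or_pos D with hD | hD
  -- Beyond `2 * A` the divisor is certainly nonzero, so the new witness is proper. For `D = 0` no
  -- residue class has to be met.
  · exact ⟨2 * A + 1, ⟨inst_ne_zero hf hA (by omega), key _ (Or.inl hD)⟩, by positivity, by linarith⟩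
  · have h1 := Int.emod_nonneg (δ - (2 * A + 1)) hP.ne'
    have h2 := Int.emod_lt_of_pos (δ - (2 * A + 1)) hP
    have h3 : P ≤ P ^ D := le_self_pow₀ hP hD.ne'
    -- The representative of `δ` modulo `P` in the window from `2 * A + 1` to `2 * A + P`.
    refine ⟨2 * A + 1 + (δ - (2 * A + 1)) % P, ⟨inst_ne_zero hf hA (by linarith),
      key _ (Or.inr ⟨-((δ - (2 * A + 1)) / P), ?_⟩)⟩, by positivity, by linarith⟩
    linear_combination Int.emod_add_mul_ediv (δ - (2 * A + 1)) P

/-! ### Reversal of the sign of the parameter -/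

/-- The parametric polynomial with `(reflect f)_δ = f_(-δ)`. -/
def reflect (f : ParamPoly) : ParamPoly := Finsupp.equivMapDomain (Equiv.neg ℤ) f

lemma reflect_apply (f : ParamPoly) (i : ℤ) : reflect f i = f (-i) := rfl

lemma inst_reflect (f : ParamPoly) (δ : ℤ) : inst (reflect f) δ = inst f (-δ) := by
  rw [inst, reflect, Finsupp.sum_equivMapDomain, inst]
  simp

lemma reflect_ne_zero {f : ParamPoly} (hf : f ≠ 0) : reflect f ≠ 0 := by
  intro h
  apply apply_ordDelta_ne_zero hf
  rw [← neg_neg (ordDelta f), ← reflect_apply, h]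
  rfl

lemma ordDelta_reflect {f : ParamPoly} (hf : f ≠ 0) : ordDelta (reflect f) = -degDelta f := by
  refine ordDelta_eq ?_ fun i hi => ?_
  · rw [reflect_apply, neg_neg]
    exact apply_degDelta_ne_zero hf
  · have := le_degDelta (reflect_apply f i ▸ hi)
    omega

lemma degDelta_reflect {f : ParamPoly} (hf : f ≠ 0) : degDelta (reflect f) = -ordDelta f := by
  refine degDelta_eq ?_ fun i hi => ?_
  · rw [reflect_apply, neg_neg]
    exact apply_ordDelta_ne_zero hf
  · have := ordDelta_le (reflect_apply f i ▸ hi)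
    omega

lemma spanGap_reflect {f g : ParamPoly} (hf : f ≠ 0) (hg : g ≠ 0) :
    spanGap (reflect f) (reflect g) = spanGap f g := by
  rw [spanGap, spanGap, ordDelta_reflect hf, ordDelta_reflect hg, degDelta_reflect hf,
    degDelta_reflect hg]
  ring

end LamplighterDiv

end

theorem mainTheorem4 (f g : LamplighterDiv.ParamPoly) (hf : f ≠ 0) (hg : g ≠ 0) (A B : ℕ)
    (hA : LamplighterDiv.IsPiecewisePeriodic A 1
      (fun δ : ℕ => LamplighterDiv.inst f (δ : ℤ)))
    (hB : LamplighterDiv.IsPiecewisePeriodic B 1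
      (fun δ : ℕ => LamplighterDiv.inst g (δ : ℤ)))
    (hAB : A ≤ B)
    (W : ℤ → Prop)
    (hW : W = LamplighterDiv.IsWitness f g ∨ W = LamplighterDiv.IsProperWitness f g)
    (hpos : ∃ δ : ℤ, W δ) :
    (∀ D : ℕ, LamplighterDiv.spanGap f g = (D : ℤ) →
      ∃ δ : ℤ, W δ ∧
        -((LamplighterDiv.period (f (LamplighterDiv.ordDelta f)) : ℤ) ^ D
            + 2 * ((B : ℤ) + 4 * A * D) + 4 * A + 1) ≤ δ ∧
        δ ≤ (LamplighterDiv.period (f (LamplighterDiv.degDelta f)) : ℤ) ^ D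
            + 2 * ((B : ℤ) + 4 * A * D) + 4 * A + 1) ∧
    (LamplighterDiv.spanGap f g < 0 →
      ∃ δ : ℤ, W δ ∧ -(2 * (B : ℤ) + 2 * A) ≤ δ ∧ δ ≤ 2 * (B : ℤ) + 2 * A) := by
  have hAs := LamplighterDiv.suppIn_of_isPiecewisePeriodic hA
  have hBs := LamplighterDiv.suppIn_of_isPiecewisePeriodic hB
  -- Both zero-divisor conventions are handled at once: `W` implies divisibility and is implied by
  -- proper witnesshood, and nothing else about it is used.
  have hWdvd : ∀ δ, W δ → LamplighterDiv.inst f δ ∣ LamplighterDiv.inst g δ := by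
    rcases hW with rfl | rfl
    · exact fun _ h => h
    · exact fun _ h => h.2
  have hWof : ∀ δ, LamplighterDiv.IsProperWitness f g δ → W δ := by
    rcases hW with rfl | rfl
    · exact fun _ h => h.2
    · exact fun _ h => h
  obtain ⟨δ, hδ⟩ := hpos
  have hdvd := hWdvd δ hδ
  have hdvd' : LamplighterDiv.inst (LamplighterDiv.reflect f) (-δ) ∣
      LamplighterDiv.inst (LamplighterDiv.reflect g) (-δ) := by
    rwa [LamplighterDiv.inst_reflect, LamplighterDiv.inst_reflect, neg_neg]
  have hf' := LamplighterDiv.reflect_ne_zero hf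
  have hg' := LamplighterDiv.reflect_ne_zero hg
  have hgap' := LamplighterDiv.spanGap_reflect hf hg
  -- For a negative gap every witness is already small, so the given one serves.
  refine ⟨fun D hD => ?_, fun hneg => ⟨δ, hδ, ?_, ?_⟩⟩
  · have hAD : 0 ≤ (A : ℤ) * D := by positivity
    have hbound : ∀ q : LamplighterDiv.Laurent, 0 ≤ (LamplighterDiv.period q : ℤ) ^ D
        + 2 * ((B : ℤ) + 4 * A * D) + 4 * A + 1 := fun q => by positivity
    by_cases hhi : (LamplighterDiv.period (f (LamplighterDiv.degDelta f)) : ℤ) ^ D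
        + 2 * ((B : ℤ) + 4 * A * D) + 4 * A + 1 < δ
    · obtain ⟨δ', h1, h2, h3⟩ := LamplighterDiv.exists_small_witness hf hAs hBs hD hdvd hhi
      exact ⟨δ', hWof _ h1, (neg_nonpos.2 (hbound _)).trans h2, h3⟩
    by_cases hlo : (LamplighterDiv.period (f (LamplighterDiv.ordDelta f)) : ℤ) ^ D
        + 2 * ((B : ℤ) + 4 * A * D) + 4 * A + 1 < -δ
    -- The last block of the reflection is the first block of `f`, which is why the lower bound
    -- involves the period of that block.
    · have hend : LamplighterDiv.reflect f (LamplighterDiv.degDelta (LamplighterDiv.reflect f)) =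
          f (LamplighterDiv.ordDelta f) := by
        rw [LamplighterDiv.degDelta_reflect hf, LamplighterDiv.reflect_apply, neg_neg]
      rw [← hend] at hlo
      obtain ⟨δ', h1, h2, h3⟩ := LamplighterDiv.exists_small_witness hf' (fun i => hAs (-i))
        (fun i => hBs (-i)) (hgap'.trans hD) hdvd' hlo
      rw [hend] at h3
      rw [LamplighterDiv.IsProperWitness, LamplighterDiv.inst_reflect,
        LamplighterDiv.inst_reflect] at h1
      exact ⟨-δ', hWof _ h1, neg_le_neg h3, (neg_nonpos.2 h2).trans (hbound _)⟩
    exact ⟨δ, hδ, by linarith, by linarith⟩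
  · have := LamplighterDiv.le_of_inst_dvd hf' hg' (fun i => hAs (-i)) (fun i => hBs (-i))
      (hgap'.trans_lt hneg) hdvd'
    linarith
  · exact LamplighterDiv.le_of_inst_dvd hf hg hAs hBs hneg hdvd
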